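/- Let $K$ be an algebraically closed field of characteristic $0$, and let $X\subset\mathbb{P}^N=\mathbb{P}^N_K$ be an irreducible projective variety (an irreducible Zariski closed subset) of dimension $n$ which is non-degenerate, i.e. whose linear span is $\mathbb{P}^N$. Let $W\subset\mathbb{P}^N$ be a hypersurface (the zero locus of a nonzero homogeneous polynomial of positive degree) properly containing $X$. For $P\in\mathbb{P}^N$ let the $X$-rank $r_X(P)$ be the least number of points of $X$ whose linear span contains $P$. Let $P\in\mathbb{P}^N\setminus W$ be such that $r_X(P)\neq 2$, and let $$Y_P:=\operatorname{cone}(P,X)=\bigcup_{x\in X}\langle x,P\rangle .$$ Then $Y_P\cap W$ is a reducible algebraic set (a union of two algebraic sets, both different from $Y_P\cap W$), and its dimension is $n$. Moreover, there exists a line $L\subseteq Y_P$ through $P$ that meets $X$ in exactly one point and meets $W\setminus X$ in at least one point. -/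

import Mathlib

open scoped LinearAlgebra.Projectivization

namespace ProjGeom

variable {K : Type*} [Field K] {N : ℕ}

/-- The vanishing of a homogeneous polynomial at a point of `ℙ^N` may be tested on any
representative of the point. -/
theorem eval_rep_eq_zero_iff {d : ℕ} {f : MvPolynomial (Fin (N + 1)) K} (hf : f.IsHomogeneous d)
    (v : Fin (N + 1) → K) (hv : v ≠ 0) :
    MvPolynomial.eval (Projectivization.mk K v hv).rep f = 0 ↔ MvPolynomial.eval v f = 0 := by
  obtain ⟨a, ha⟩ := Projectivization.exists_smul_eq_mk_rep K v hv
  have h : MvPolynomial.eval ((a : K) • v) f = (a : K) ^ d * MvPolynomial.eval v f := by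
    rw [MvPolynomial.eval_eq, MvPolynomial.eval_eq, Finset.mul_sum]
    refine Finset.sum_congr rfl fun m hm => ?_
    have hd : ∑ i ∈ m.support, m i = d := by
      have := hf (MvPolynomial.mem_support_iff.mp hm)
      simpa [Finsupp.weight_apply, Finsupp.sum] using this
    simp only [Pi.smul_apply, smul_eq_mul, mul_pow]
    rw [Finset.prod_mul_distrib, Finset.prod_pow_eq_pow_sum, hd]
    ring
  have ha' : (a : K) • v = (Projectivization.mk K v hv).rep := ha
  rw [← ha', h]
  simp

/-- The set of common zeros in `ℙ^N` of a set `S` of polynomials; it is used only when every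
member of `S` is homogeneous. -/
def zeroLocus (S : Set (MvPolynomial (Fin (N + 1)) K)) : Set (ℙ K (Fin (N + 1) → K)) :=
  {p | ∀ f ∈ S, MvPolynomial.eval p.rep f = 0}

/-- The algebraic subsets of `ℙ^N`: common zero loci of sets of homogeneous polynomials. -/
def IsAlgebraicSet (Z : Set (ℙ K (Fin (N + 1) → K))) : Prop :=
  ∃ S : Set (MvPolynomial (Fin (N + 1)) K), (∀ f ∈ S, ∃ d, f.IsHomogeneous d) ∧ Z = zeroLocus S

/-- The Zariski topology of `ℙ^N`, whose closed sets are the algebraic sets. -/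
instance zariskiTopology : TopologicalSpace (ℙ K (Fin (N + 1) → K)) :=
  TopologicalSpace.ofClosed {Z | IsAlgebraicSet Z}
    ⟨{1}, by rintro f rfl; exact ⟨0, MvPolynomial.isHomogeneous_one _ _⟩, by
      ext p; simp [zeroLocus]⟩
    (by
      intro A hA
      refine ⟨{f | (∃ d, f.IsHomogeneous d) ∧ ∃ Z ∈ A, ∀ p ∈ Z, MvPolynomial.eval p.rep f = 0},
        fun f hf => hf.1, ?_⟩
      ext p
      constructor
      · rintro hp f ⟨-, Z, hZ, h⟩
        exact h p (hp Z hZ)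
      · intro hp Z hZ
        obtain ⟨S, hS, rfl⟩ := hA hZ
        exact fun f hf => hp f ⟨hS f hf, _, hZ, fun q hq => hq f hf⟩)
    (by
      rintro _ ⟨S, hS, rfl⟩ _ ⟨T, hT, rfl⟩
      refine ⟨{h | ∃ f ∈ S, ∃ g ∈ T, h = f * g}, ?_, ?_⟩
      · rintro _ ⟨f, hf, g, hg, rfl⟩
        obtain ⟨d, hd⟩ := hS f hf
        obtain ⟨e, he⟩ := hT g hg
        exact ⟨d + e, hd.mul he⟩
      · ext p
        constructor
        · rintro (hp | hp) _ ⟨f, hf, g, hg, rfl⟩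
          · simp [hp f hf]
          · simp [hp g hg]
        · intro hp
          by_contra hcon
          simp only [Set.mem_union, not_or, zeroLocus, Set.mem_ofPred_eq, not_forall] at hcon
          obtain ⟨⟨f, hf, hf0⟩, g, hg, hg0⟩ := hcon
          have := hp (f * g) ⟨f, hf, g, hg, rfl⟩
          rw [map_mul, mul_eq_zero] at this
          exact this.elim hf0 hg0)

theorem isClosed_iff {Z : Set (ℙ K (Fin (N + 1) → K))} : IsClosed Z ↔ IsAlgebraicSet Z := by
  rw [← isOpen_compl_iff]
  change IsAlgebraicSet Zᶜᶜ ↔ _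
  rw [compl_compl]

/-- An irreducible projective variety: an irreducible Zariski closed subset of `ℙ^N`. -/
def IsIrreducibleVariety (X : Set (ℙ K (Fin (N + 1) → K))) : Prop :=
  IsClosed X ∧ IsIrreducible X

/-- `X` is non-degenerate: its linear span is the whole `ℙ^N`. -/
def IsNondegenerate (X : Set (ℙ K (Fin (N + 1) → K))) : Prop :=
  Projectivization.Subspace.span X = ⊤

/-- A hypersurface: the zero locus of one nonzero homogeneous polynomial of positive degree. -/
def IsHypersurface (W : Set (ℙ K (Fin (N + 1) → K))) : Prop :=
  ∃ (d : ℕ) (f : MvPolynomial (Fin (N + 1)) K),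
    0 < d ∧ f ≠ 0 ∧ f.IsHomogeneous d ∧ W = zeroLocus {f}

/-- `Z` is a reducible algebraic set: the union of two algebraic sets, both different from `Z`. -/
def IsReducible (Z : Set (ℙ K (Fin (N + 1) → K))) : Prop :=
  ∃ A B : Set (ℙ K (Fin (N + 1) → K)),
    IsClosed A ∧ IsClosed B ∧ Z = A ∪ B ∧ A ≠ Z ∧ B ≠ Z

/-- The dimension of `Z ⊆ ℙ^N`: its Krull dimension in the induced Zariski topology. -/
noncomputable def dim (Z : Set (ℙ K (Fin (N + 1) → K))) : WithBot ℕ∞ :=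
  topologicalKrullDim Z

/-- The `X`-rank of `P`: the least number of points of `X` whose linear span contains `P`
(and `⊤` if there are no such points). -/
noncomputable def rank (X : Set (ℙ K (Fin (N + 1) → K))) (P : ℙ K (Fin (N + 1) → K)) : ℕ∞ :=
  ⨅ (S : Finset (ℙ K (Fin (N + 1) → K))) (_ : (S : Set (ℙ K (Fin (N + 1) → K))) ⊆ X)
    (_ : P ∈ Projectivization.Subspace.span (S : Set (ℙ K (Fin (N + 1) → K)))), (S.card : ℕ∞)

/-- The cone over `X` with vertex `P`: the union of the linear spans `⟨x, P⟩` for `x ∈ X`. -/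
def cone (P : ℙ K (Fin (N + 1) → K)) (X : Set (ℙ K (Fin (N + 1) → K))) :
    Set (ℙ K (Fin (N + 1) → K)) :=
  ⋃ x ∈ X, (Projectivization.Subspace.span {x, P} : Set (ℙ K (Fin (N + 1) → K)))

/-- A line: a linear subspace of `ℙ^N` whose underlying vector space has dimension two. -/
def IsLine (L : Projectivization.Subspace K (Fin (N + 1) → K)) : Prop :=
  Module.finrank K (Projectivization.Subspace.submodule L) = 2

end ProjGeom

/-! Let `f` define `W` and let `p` represent `P`. Restricted to a line `v + T p`, `f` has leading
coefficient `f(p)`, a constant that is nonzero because `P ∉ W`; so projection from `P` is finite on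
`W`. Lying over then makes cones over closed subsets of `W` closed (`isClosed_cone`), and
incomparability shows that an irreducible `Z ⊆ W` has no proper closed subset with the same
projection (`subset_of_subset_cone`). Since `P ∉ X`, rank different from 2 says that the projection
is injective on `X`.

The set `cone P X ∩ W` has the same projection as its closed subset `X`, so if it were irreducible
it would equal `X`. Then each line joining `P` to a point `v` of `X` would meet `W` only at `v`,
forcing `f(v + T p) = f(p) T ^ d`. Differentiating `f` `d - 1` times along `p` gives, in
characteristic 0, a linear form vanishing on `X` but not at `P`, against nondegeneracy
(`not_cone_inter_subset`). A point of the cone in `W \ X` also supplies the line `L`.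

For the dimension, `Z ↦ X ∩ cone P Z` is strictly increasing from irreducible closed subsets of
`cone P X ∩ W` to those of `X`; the other inequality comes from `X ⊆ cone P X ∩ W`. -/

namespace ProjGeom

/-! ### Projective spans in terms of linear spans -/

section Span

variable {K V : Type*} [Field K] [AddCommGroup V] [Module K V]

theorem mk_mem_span_image_iff (S : Set (ℙ K V)) {w : V} (hw : w ≠ 0) :
    Projectivization.mk K w hw ∈ Projectivization.Subspace.span S ↔
      w ∈ Submodule.span K {v : V | ∃ hv : v ≠ 0, Projectivization.mk K v hv ∈ S} := by
  constructor
  · intro h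
    rw [Projectivization.Subspace.mem_span] at h
    refine (Submodule.mk_mem_projectivization_iff _ hw).1
      (h (Submodule.projectivization (Submodule.span K _)) fun x hx => ?_)
    induction x using Projectivization.ind with
    | h v hv => exact (Submodule.mk_mem_projectivization_iff _ hv).2 (Submodule.subset_span ⟨hv, hx⟩)
  · intro h
    rw [← Projectivization.Subspace.mem_submodule_iff _ hw]
    refine Submodule.span_le.2 ?_ h
    rintro v ⟨hv, hx⟩
    exact (Projectivization.Subspace.mem_submodule_iff _ hv).2
      (Projectivization.Subspace.subset_span S hx)

theorem mk_mem_span_pair_iff {x y w : V} (hx : x ≠ 0) (hy : y ≠ 0) (hw : w ≠ 0) :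
    Projectivization.mk K w hw ∈ Projectivization.Subspace.span
      {Projectivization.mk K x hx, Projectivization.mk K y hy} ↔
      w ∈ Submodule.span K {x, y} := by
  rw [mk_mem_span_image_iff]
  have : Submodule.span K {v : V | ∃ hv : v ≠ 0, Projectivization.mk K v hv ∈
      ({Projectivization.mk K x hx, Projectivization.mk K y hy} : Set (ℙ K V))} =
      Submodule.span K {x, y} := by
    apply le_antisymm
    · rw [Submodule.span_le]
      rintro v ⟨hv, h⟩
      rcases h with h | h
      · obtain ⟨a, rfl⟩ := (Projectivization.mk_eq_mk_iff' K _ _ hv hx).1 h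
        exact Submodule.smul_mem _ _ (Submodule.subset_span (by simp))
      · obtain ⟨a, rfl⟩ := (Projectivization.mk_eq_mk_iff' K _ _ hv hy).1 h
        exact Submodule.smul_mem _ _ (Submodule.subset_span (by simp))
    · apply Submodule.span_mono
      rintro v (rfl | rfl)
      · exact ⟨hx, by simp⟩
      · exact ⟨hy, by simp⟩
  rw [this]

theorem submodule_span_pair {x y : V} (hx : x ≠ 0) (hy : y ≠ 0) :
    Projectivization.Subspace.submodule (Projectivization.Subspace.span
      {Projectivization.mk K x hx, Projectivization.mk K y hy}) = Submodule.span K {x, y} := by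
  ext w
  by_cases hw : w = 0
  · simp [hw]
  · rw [Projectivization.Subspace.mem_submodule_iff _ hw, mk_mem_span_pair_iff]

theorem mem_span_singleton_iff {P Q : ℙ K V} :
    P ∈ Projectivization.Subspace.span {Q} ↔ P = Q := by
  induction P using Projectivization.ind with
  | h v hv =>
  induction Q using Projectivization.ind with
  | h w hw =>
  rw [← Set.pair_eq_singleton, mk_mem_span_pair_iff, Projectivization.mk_eq_mk_iff',
    Set.pair_eq_singleton, Submodule.mem_span_singleton]

theorem mem_span_pair_exchange {P Q R : ℙ K V} (h : Q ∈ Projectivization.Subspace.span {R, P})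
    (hQP : Q ≠ P) : R ∈ Projectivization.Subspace.span {Q, P} := by
  induction P using Projectivization.ind with
  | h p hp =>
  induction Q using Projectivization.ind with
  | h q hq =>
  induction R using Projectivization.ind with
  | h r hr =>
  rw [mk_mem_span_pair_iff] at h ⊢
  obtain ⟨a, b, rfl⟩ := Submodule.mem_span_pair.1 h
  have ha : a ≠ 0 := by
    rintro rfl
    exact hQP ((Projectivization.mk_eq_mk_iff' K _ _ hq hp).2 ⟨b, by simp⟩)
  refine Submodule.mem_span_pair.2 ⟨a⁻¹, -(a⁻¹ * b), ?_⟩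
  rw [smul_add, smul_smul, smul_smul, inv_mul_cancel₀ ha, neg_smul]
  simp

end Span

/-! ### Cones and rank -/

variable {K : Type*} [Field K] {N : ℕ}

theorem mem_cone {P Q : ℙ K (Fin (N + 1) → K)} {X : Set (ℙ K (Fin (N + 1) → K))} :
    Q ∈ cone P X ↔ ∃ x ∈ X, Q ∈ Projectivization.Subspace.span {x, P} := by
  simp [cone]

theorem cone_mono (P : ℙ K (Fin (N + 1) → K)) {A B : Set (ℙ K (Fin (N + 1) → K))} (h : A ⊆ B) :
    cone P A ⊆ cone P B :=
  Set.biUnion_subset_biUnion_left h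

theorem cone_union (P : ℙ K (Fin (N + 1) → K)) (A B : Set (ℙ K (Fin (N + 1) → K))) :
    cone P (A ∪ B) = cone P A ∪ cone P B :=
  Set.biUnion_union _ _ _

theorem subset_cone (P : ℙ K (Fin (N + 1) → K)) (A : Set (ℙ K (Fin (N + 1) → K))) :
    A ⊆ cone P A := fun x hx =>
  mem_cone.2 ⟨x, hx, Projectivization.Subspace.subset_span _ (by simp)⟩

theorem cone_cone_subset (P : ℙ K (Fin (N + 1) → K)) (A : Set (ℙ K (Fin (N + 1) → K))) :
    cone P (cone P A) ⊆ cone P A := by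
  intro Q hQ
  obtain ⟨y, hy, hQ⟩ := mem_cone.1 hQ
  obtain ⟨x, hx, hyx⟩ := mem_cone.1 hy
  refine mem_cone.2 ⟨x, hx, ?_⟩
  exact Projectivization.Subspace.span_le_subspace_iff.2 (Set.insert_subset hyx
    (Set.singleton_subset_iff.2 (Projectivization.Subspace.subset_span _ (by simp)))) hQ

/-- Away from the vertex, membership in a cone depends only on the projection from `P`. -/
theorem mem_cone_of_mem_cone {P Q R : ℙ K (Fin (N + 1) → K)}
    {Z : Set (ℙ K (Fin (N + 1) → K))} (hQ : Q ∈ Projectivization.Subspace.span {R, P})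
    (hQP : Q ≠ P) (hZ : Q ∈ cone P Z) : R ∈ cone P Z :=
  cone_cone_subset P Z (mem_cone.2 ⟨Q, hZ, mem_span_pair_exchange hQ hQP⟩)

theorem rank_eq_two {X : Set (ℙ K (Fin (N + 1) → K))} {P x y : ℙ K (Fin (N + 1) → K)}
    (hP : P ∉ X) (hx : x ∈ X) (hy : y ∈ X)
    (h : P ∈ Projectivization.Subspace.span {x, y}) : rank X P = 2 := by
  classical
  apply le_antisymm
  · refine iInf_le_of_le ({x, y} : Finset (ℙ K (Fin (N + 1) → K))) (iInf_le_of_le ?_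
      (iInf_le_of_le ?_ ?_))
    · simp [Set.insert_subset_iff, hx, hy]
    · simpa using h
    · exact_mod_cast Finset.card_le_two
  · refine le_iInf fun S => le_iInf fun hS => le_iInf fun hPS => ?_
    by_contra! hlt
    have hlt : S.card < 2 := by exact_mod_cast hlt
    obtain h0 | h1 : S.card = 0 ∨ S.card = 1 := by omega
    · rw [Finset.card_eq_zero] at h0
      subst h0
      rw [Finset.coe_empty, Projectivization.Subspace.span_empty] at hPS
      have : P ∈ ((⊥ : Projectivization.Subspace K (Fin (N + 1) → K)) : Set _) := hPS
      rw [Projectivization.Subspace.bot_coe] at this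
      exact this
    · obtain ⟨a, rfl⟩ := Finset.card_eq_one.1 h1
      rw [Finset.coe_singleton, mem_span_singleton_iff] at hPS
      exact hP (hPS ▸ hS (by simp))

/-- Injectivity of the projection from `P` on `X`: two distinct points of `X` collinear with `P`
would span a line through `P`, giving rank 2. -/
theorem eq_of_mem_span_pair_of_rank_ne_two {X : Set (ℙ K (Fin (N + 1) → K))}
    {P x y : ℙ K (Fin (N + 1) → K)} (hP : P ∉ X) (hrank : rank X P ≠ 2) (hx : x ∈ X) (hy : y ∈ X)
    (h : y ∈ Projectivization.Subspace.span {x, P}) : y = x := by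
  by_contra hne
  rw [Set.pair_comm] at h
  exact hrank (rank_eq_two hP hy hx (mem_span_pair_exchange h hne))

theorem inter_cone_of_rank_ne_two {X A : Set (ℙ K (Fin (N + 1) → K))}
    {P : ℙ K (Fin (N + 1) → K)} (hP : P ∉ X) (hrank : rank X P ≠ 2) (hA : A ⊆ X) :
    X ∩ cone P A ⊆ A := by
  rintro y ⟨hy, hyA⟩
  obtain ⟨x, hx, h⟩ := mem_cone.1 hyA
  exact eq_of_mem_span_pair_of_rank_ne_two hP hrank (hA hx) hy h ▸ hx

/-! ### Restriction of a form to a line -/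

section Line

variable {K A : Type*} [Field K] [CommRing A] [Algebra K A] {σ : Type*}

/-- The restriction of a polynomial to the parametrized line `T ↦ v + T p`. -/
noncomputable def lineRestrict (v p : σ → A) : MvPolynomial σ K →ₐ[K] Polynomial A :=
  MvPolynomial.aeval fun j => Polynomial.C (v j) + Polynomial.C (p j) * Polynomial.X

theorem lineRestrict_X (v p : σ → A) (j : σ) :
    lineRestrict (K := K) v p (MvPolynomial.X j) =
      Polynomial.C (v j) + Polynomial.C (p j) * Polynomial.X := by
  simp [lineRestrict]

theorem lineRestrict_C (v p : σ → A) (a : K) :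
    lineRestrict v p (MvPolynomial.C a) = Polynomial.C (algebraMap K A a) := by
  simp [lineRestrict]

/-- The two claims share one induction: the top coefficient of a product is multiplicative only
relative to degree bounds on the factors. -/
theorem natDegree_prod_linear_le (v p : σ → A) (m : σ → ℕ) (s : Finset σ) :
    (∏ j ∈ s, (Polynomial.C (v j) + Polynomial.C (p j) * Polynomial.X) ^ m j).natDegree ≤
      ∑ j ∈ s, m j ∧
    (∏ j ∈ s, (Polynomial.C (v j) + Polynomial.C (p j) * Polynomial.X) ^ m j).coeff
      (∑ j ∈ s, m j) = ∏ j ∈ s, p j ^ m j := by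
  classical
  have h1 : ∀ j, (Polynomial.C (v j) + Polynomial.C (p j) * Polynomial.X).natDegree ≤ 1 := by
    intro j
    compute_degree
  have h2 : ∀ j, ((Polynomial.C (v j) + Polynomial.C (p j) * Polynomial.X) ^ m j).natDegree ≤
      m j := fun j => by simpa using Polynomial.natDegree_pow_le_of_le (m j) (h1 j)
  induction s using Finset.induction_on with
  | empty => simp
  | insert a s ha ih =>
    rw [Finset.prod_insert ha, Finset.sum_insert ha, Finset.prod_insert ha]
    refine ⟨Polynomial.natDegree_mul_le_of_le (h2 a) ih.1, ?_⟩
    rw [Polynomial.coeff_mul_add_eq_of_natDegree_le (h2 a) ih.1, ih.2]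
    have := Polynomial.coeff_pow_of_natDegree_le (m := m a) (h1 a)
    rw [mul_one] at this
    rw [this]
    simp [Polynomial.coeff_C]

theorem lineRestrict_eq_sum (v p : σ → A) (f : MvPolynomial σ K) :
    lineRestrict v p f = ∑ m ∈ f.support, Polynomial.C (algebraMap K A (f.coeff m)) *
      ∏ j ∈ m.support, (Polynomial.C (v j) + Polynomial.C (p j) * Polynomial.X) ^ m j := by
  rw [lineRestrict, MvPolynomial.aeval_def, MvPolynomial.eval₂_eq]
  rfl

theorem sum_support_eq_of_isHomogeneous {d : ℕ} {f : MvPolynomial σ K} (hf : f.IsHomogeneous d)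
    {m : σ →₀ ℕ} (hm : m ∈ f.support) : ∑ i ∈ m.support, m i = d := by
  have := hf (MvPolynomial.mem_support_iff.mp hm)
  simpa [Finsupp.weight_apply, Finsupp.sum] using this

theorem natDegree_lineRestrict_le {d : ℕ} {f : MvPolynomial σ K} (hf : f.IsHomogeneous d)
    (v p : σ → A) : (lineRestrict v p f).natDegree ≤ d := by
  rw [lineRestrict_eq_sum]
  refine Polynomial.natDegree_sum_le_of_forall_le _ _ fun m hm => ?_
  refine (Polynomial.natDegree_C_mul_le _ _).trans ?_
  rw [← sum_support_eq_of_isHomogeneous hf hm]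
  exact (natDegree_prod_linear_le v p m m.support).1

theorem coeff_lineRestrict {d : ℕ} {f : MvPolynomial σ K} (hf : f.IsHomogeneous d)
    (v p : σ → A) : (lineRestrict v p f).coeff d = MvPolynomial.aeval p f := by
  rw [lineRestrict_eq_sum, Polynomial.finsetSum_coeff, MvPolynomial.aeval_def,
    MvPolynomial.eval₂_eq]
  refine Finset.sum_congr rfl fun m hm => ?_
  rw [Polynomial.coeff_C_mul]
  congr 1
  rw [← sum_support_eq_of_isHomogeneous hf hm]
  exact (natDegree_prod_linear_le v p m m.support).2

theorem eval_lineRestrict (v p : σ → K) (f : MvPolynomial σ K) (t : K) :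
    (lineRestrict v p f).eval t = MvPolynomial.eval (v + t • p) f := by
  have : ((Polynomial.evalRingHom t).comp (lineRestrict v p : MvPolynomial σ K →ₐ[K] _).toRingHom) =
      MvPolynomial.eval (v + t • p) := by
    refine MvPolynomial.ringHom_ext (fun a => ?_) fun j => ?_
    · simp
    · simp [lineRestrict_X, mul_comm t]
  exact DFunLike.congr_fun this f

end Line

/-! ### The homogeneous ideal of a projective set -/

section VanishingIdeal

variable {K : Type*} [Field K] {N : ℕ}

theorem eval_smul_of_isHomogeneous {σ : Type*} {d : ℕ} {f : MvPolynomial σ K}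
    (hf : f.IsHomogeneous d) (a : K) (v : σ → K) :
    MvPolynomial.eval (a • v) f = a ^ d * MvPolynomial.eval v f := by
  rw [MvPolynomial.eval_eq, MvPolynomial.eval_eq, Finset.mul_sum]
  refine Finset.sum_congr rfl fun m hm => ?_
  simp only [Pi.smul_apply, smul_eq_mul, mul_pow]
  rw [Finset.prod_mul_distrib, Finset.prod_pow_eq_pow_sum, sum_support_eq_of_isHomogeneous hf hm]
  ring

/-- The polynomials vanishing on the affine cone over `Z`. -/
def coneIdeal (Z : Set (ℙ K (Fin (N + 1) → K))) : Ideal (MvPolynomial (Fin (N + 1)) K) where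
  carrier := {g | ∀ (v : Fin (N + 1) → K) (hv : v ≠ 0), Projectivization.mk K v hv ∈ Z →
    MvPolynomial.eval v g = 0}
  add_mem' hf hg v hv h := by rw [map_add, hf v hv h, hg v hv h, add_zero]
  zero_mem' _ _ _ := map_zero _
  smul_mem' a g hg v hv h := by rw [smul_eq_mul, map_mul, hg v hv h, mul_zero]

theorem coneIdeal_anti {Y Z : Set (ℙ K (Fin (N + 1) → K))} (h : Y ⊆ Z) :
    coneIdeal Z ≤ coneIdeal Y := fun _ hg v hv hvY => hg v hv (h hvY)

theorem mk_mem_zeroLocus_singleton {d : ℕ} {f : MvPolynomial (Fin (N + 1)) K}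
    (hf : f.IsHomogeneous d) {v : Fin (N + 1) → K} (hv : v ≠ 0) :
    Projectivization.mk K v hv ∈ zeroLocus {f} ↔ MvPolynomial.eval v f = 0 := by
  simp [zeroLocus, eval_rep_eq_zero_iff hf v hv]

/-- The values at `v` of the components of `g` are the coefficients of the polynomial `a ↦ g(a v)`,
which vanishes for all of the infinitely many `a ≠ 0`. -/
theorem homogeneousComponent_mem_coneIdeal [Infinite K] {Z : Set (ℙ K (Fin (N + 1) → K))}
    {g : MvPolynomial (Fin (N + 1)) K} (hg : g ∈ coneIdeal Z) (i : ℕ) :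
    MvPolynomial.homogeneousComponent i g ∈ coneIdeal Z := by
  intro v hv hvZ
  set Q : Polynomial K := ∑ i ∈ Finset.range (g.totalDegree + 1),
    Polynomial.C (MvPolynomial.eval v (MvPolynomial.homogeneousComponent i g)) *
      Polynomial.X ^ i with hQ
  have hQeval : ∀ a : K, Q.eval a = MvPolynomial.eval (a • v) g := by
    intro a
    conv_rhs => rw [← MvPolynomial.sum_homogeneousComponent g]
    rw [hQ, Polynomial.eval_finsetSum, map_sum]
    refine Finset.sum_congr rfl fun i _ => ?_
    rw [eval_smul_of_isHomogeneous (MvPolynomial.homogeneousComponent_isHomogeneous i g)]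
    rw [Polynomial.eval_mul, Polynomial.eval_C, Polynomial.eval_pow, Polynomial.eval_X, mul_comm]
  have hQ0 : Q = 0 := by
    refine Polynomial.eq_zero_of_infinite_isRoot Q
      (Set.Infinite.mono (s := {0}ᶜ) ?_ (Set.finite_singleton (0 : K)).infinite_compl)
    intro a ha
    have ha' : a ≠ 0 := ha
    have hav : a • v ≠ 0 := smul_ne_zero ha' hv
    change Q.eval a = 0
    rw [hQeval]
    refine hg _ hav ?_
    rwa [(Projectivization.mk_eq_mk_iff' K _ _ hav hv).2 ⟨a, rfl⟩]
  by_cases hi : i < g.totalDegree + 1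
  · have := congrArg (Polynomial.coeff · i) hQ0
    simpa [hQ, Polynomial.finsetSum_coeff, Polynomial.coeff_X_pow, Nat.lt_succ_iff.1 hi] using this
  · rw [MvPolynomial.homogeneousComponent_eq_zero _ _ (by omega), map_zero]

theorem mk_mem_of_isClosed {Z : Set (ℙ K (Fin (N + 1) → K))} (hZ : IsClosed Z)
    {v : Fin (N + 1) → K} (hv : v ≠ 0) (h : ∀ g ∈ coneIdeal Z, MvPolynomial.eval v g = 0) :
    Projectivization.mk K v hv ∈ Z := by
  obtain ⟨S, hS, rfl⟩ := isClosed_iff.1 hZ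
  intro f hf
  obtain ⟨d, hd⟩ := hS f hf
  rw [eval_rep_eq_zero_iff hd]
  exact h f fun w hw hwZ => (eval_rep_eq_zero_iff hd w hw).1 (hwZ f hf)

theorem isClosed_of_forall_coneIdeal [Infinite K] {Z : Set (ℙ K (Fin (N + 1) → K))}
    (h : ∀ (v : Fin (N + 1) → K) (hv : v ≠ 0), (∀ g ∈ coneIdeal Z, MvPolynomial.eval v g = 0) →
      Projectivization.mk K v hv ∈ Z) : IsClosed Z := by
  refine isClosed_iff.2 ⟨{g | g ∈ coneIdeal Z ∧ ∃ d, g.IsHomogeneous d}, fun f hf => hf.2, ?_⟩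
  ext Q
  induction Q using Projectivization.ind with
  | h v hv =>
  constructor
  · rintro hQ f ⟨hf, d, hd⟩
    exact (eval_rep_eq_zero_iff hd v hv).2 (hf v hv hQ)
  · intro hQ
    refine h v hv fun g hg => ?_
    rw [← MvPolynomial.sum_homogeneousComponent g, map_sum]
    refine Finset.sum_eq_zero fun i _ => ?_
    have hi := MvPolynomial.homogeneousComponent_isHomogeneous i g
    exact (eval_rep_eq_zero_iff hi v hv).1
      (hQ _ ⟨homogeneousComponent_mem_coneIdeal hg i, i, hi⟩)

attribute [local instance] MvPolynomial.gradedAlgebra in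
theorem isHomogeneous_coneIdeal [Infinite K] (Z : Set (ℙ K (Fin (N + 1) → K))) :
    (coneIdeal Z).IsHomogeneous (MvPolynomial.homogeneousSubmodule (Fin (N + 1)) K) := by
  intro i g hg
  have := homogeneousComponent_mem_coneIdeal hg i
  rwa [← MvPolynomial.decomposition.decompose'_apply] at this

theorem isClosed_zeroLocus_singleton {d : ℕ} {f : MvPolynomial (Fin (N + 1)) K}
    (hf : f.IsHomogeneous d) : IsClosed (zeroLocus {f}) :=
  isClosed_iff.2 ⟨{f}, by rintro _ rfl; exact ⟨d, hf⟩, rfl⟩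

attribute [local instance] MvPolynomial.gradedAlgebra in
-- For a homogeneous ideal primality need only be tested on homogeneous elements, whose zero loci
-- are closed in `ℙ^N`.
theorem isPrime_coneIdeal [Infinite K] {Z : Set (ℙ K (Fin (N + 1) → K))} (hZ : IsIrreducible Z) :
    (coneIdeal Z).IsPrime := by
  refine (isHomogeneous_coneIdeal Z).isPrime_of_homogeneous_mem_or_mem ?_ ?_
  · obtain ⟨Q, hQ⟩ := hZ.nonempty
    induction Q using Projectivization.ind with
    | h v hv =>
    rw [Ideal.ne_top_iff_one]
    intro h1
    simpa using h1 v hv hQ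
  · rintro g h ⟨d, hg⟩ ⟨e, hh⟩ hgh
    have hg : g.IsHomogeneous d := hg
    have hh : h.IsHomogeneous e := hh
    have key := isPreirreducible_iff_isClosed_union_isClosed.1 hZ.isPreirreducible _ _
      (isClosed_zeroLocus_singleton hg) (isClosed_zeroLocus_singleton hh) ?_
    · refine key.imp (fun H v hv hvZ => ?_) fun H v hv hvZ => ?_
      · exact (mk_mem_zeroLocus_singleton hg hv).1 (H hvZ)
      · exact (mk_mem_zeroLocus_singleton hh hv).1 (H hvZ)
    · intro Q hQ
      induction Q using Projectivization.ind with
      | h v hv =>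
      have := hgh v hv hQ
      rw [map_mul, mul_eq_zero] at this
      exact this.imp (mk_mem_zeroLocus_singleton hg hv).2 (mk_mem_zeroLocus_singleton hh hv).2

end VanishingIdeal

/-! ### Finiteness of the projection from a point off a hypersurface -/

section Projection

variable {K : Type*} [Field K] {N : ℕ}

/-- The pullback of polynomials along the linear projection `v ↦ v - v i • p`. -/
noncomputable def projHom (i : Fin (N + 1)) (p : Fin (N + 1) → K) :
    MvPolynomial (Fin (N + 1)) K →ₐ[K] MvPolynomial (Fin (N + 1)) K :=
  MvPolynomial.aeval fun j => MvPolynomial.X j - MvPolynomial.C (p j) * MvPolynomial.X i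

theorem projHom_X (i : Fin (N + 1)) (p : Fin (N + 1) → K) (j : Fin (N + 1)) :
    projHom i p (MvPolynomial.X j) =
      MvPolynomial.X j - MvPolynomial.C (p j) * MvPolynomial.X i := by
  simp [projHom]

theorem eval_projHom (i : Fin (N + 1)) (p v : Fin (N + 1) → K)
    (g : MvPolynomial (Fin (N + 1)) K) :
    MvPolynomial.eval v (projHom i p g) = MvPolynomial.eval (v - v i • p) g := by
  have : (MvPolynomial.eval v).comp (projHom i p).toRingHom = MvPolynomial.eval (v - v i • p) := by
    refine MvPolynomial.ringHom_ext (fun a => ?_) fun j => ?_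
    · simp [projHom]
    · simp [projHom_X, mul_comm (v i)]
  exact DFunLike.congr_fun this g

theorem mk_mem_cone_iff {p w : Fin (N + 1) → K} (hp : p ≠ 0) (hw : w ≠ 0)
    {Z : Set (ℙ K (Fin (N + 1) → K))} :
    Projectivization.mk K w hw ∈ cone (Projectivization.mk K p hp) Z ↔
      ∃ (v : Fin (N + 1) → K) (hv : v ≠ 0), Projectivization.mk K v hv ∈ Z ∧
        ∃ a b : K, a • v + b • p = w := by
  rw [mem_cone]
  constructor
  · rintro ⟨x, hx, h⟩
    induction x using Projectivization.ind with
    | h v hv =>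
    rw [mk_mem_span_pair_iff] at h
    exact ⟨v, hv, hx, Submodule.mem_span_pair.1 h⟩
  · rintro ⟨v, hv, hx, h⟩
    exact ⟨_, hx, (mk_mem_span_pair_iff hv hp hw).2 (Submodule.mem_span_pair.2 h)⟩

theorem eval_zero_of_mem_coneIdeal [Infinite K] {Z : Set (ℙ K (Fin (N + 1) → K))}
    (hZ : Z.Nonempty) {g : MvPolynomial (Fin (N + 1)) K} (hg : g ∈ coneIdeal Z) :
    MvPolynomial.eval 0 g = 0 := by
  obtain ⟨Q, hQ⟩ := hZ
  induction Q using Projectivization.ind with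
  | h v hv =>
  have := homogeneousComponent_mem_coneIdeal hg 0 v hv hQ
  rw [MvPolynomial.homogeneousComponent_zero, MvPolynomial.eval_C] at this
  simpa [MvPolynomial.constantCoeff_eq] using this

/-- As `p i = 1`, the projection kills `p`, so pulled-back polynomials are constant in the direction
`p` and vanish on the cone once they vanish on `Z`. -/
theorem comap_projHom_coneIdeal_le [Infinite K] {Z : Set (ℙ K (Fin (N + 1) → K))}
    {i : Fin (N + 1)} {p : Fin (N + 1) → K} (hp : p ≠ 0) (hpi : p i = 1) :
    (coneIdeal Z).comap (projHom i p).toRingHom ≤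
      (coneIdeal (cone (Projectivization.mk K p hp) Z)).comap (projHom i p).toRingHom := by
  intro g hg w hw hwZ
  obtain ⟨v, hv, hvZ, a, b, rfl⟩ := (mk_mem_cone_iff hp hw).1 hwZ
  change projHom i p g ∈ coneIdeal Z at hg
  change MvPolynomial.eval _ (projHom i p g) = 0
  have heq : MvPolynomial.eval (a • v + b • p) (projHom i p g) =
      MvPolynomial.eval (a • v) (projHom i p g) := by
    rw [eval_projHom, eval_projHom]
    congr 2
    ext j
    simp [hpi]
    ring
  rw [heq]
  -- For `a = 0` the point is the vertex, and the value wanted is the constant term.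
  by_cases ha : a = 0
  · rw [ha, zero_smul]
    exact eval_zero_of_mem_coneIdeal ⟨_, hvZ⟩ hg
  · have hav : a • v ≠ 0 := smul_ne_zero ha hv
    refine hg _ hav ?_
    rwa [(Projectivization.mk_eq_mk_iff' K _ _ hav hv).2 ⟨a, rfl⟩]

/-- With `π v = v - v i • p`, the relation `f(π v + T p) = 0` holds at `T = v i` modulo `I`, with
leading coefficient `f(p)`. Hence `X i` is integral, and so is each `X j = π_j + p_j X i`. -/
theorem isIntegral_projHom {i : Fin (N + 1)} {p : Fin (N + 1) → K} {d : ℕ}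
    {f : MvPolynomial (Fin (N + 1)) K} (hf : f.IsHomogeneous d) (hfp : MvPolynomial.eval p f ≠ 0)
    {I : Ideal (MvPolynomial (Fin (N + 1)) K)} (hI : f ∈ I) :
    ((Ideal.Quotient.mk I).comp (projHom i p).toRingHom).IsIntegral := by
  set φ := (Ideal.Quotient.mk I).comp (projHom i p).toRingHom with hφ
  have hC : ∀ a : K, φ (MvPolynomial.C a) = Ideal.Quotient.mk I (MvPolynomial.C a) := by
    intro a
    simp [hφ, projHom, MvPolynomial.algebraMap_eq]
  have hX : ∀ j, φ (MvPolynomial.X j) = Ideal.Quotient.mk I (MvPolynomial.X j) -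
      Ideal.Quotient.mk I (MvPolynomial.C (p j)) * Ideal.Quotient.mk I (MvPolynomial.X i) := by
    intro j
    have : φ (MvPolynomial.X j) = Ideal.Quotient.mk I (projHom i p (MvPolynomial.X j)) := rfl
    rw [this, projHom_X, map_sub, map_mul]
  have hXi : φ.IsIntegralElem (Ideal.Quotient.mk I (MvPolynomial.X i)) := by
    set F : Polynomial (MvPolynomial (Fin (N + 1)) K) :=
      lineRestrict (K := K) MvPolynomial.X (fun j => MvPolynomial.C (p j)) f with hF
    have hev : F.eval₂ φ (Ideal.Quotient.mk I (MvPolynomial.X i)) = 0 := by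
      have : (Polynomial.eval₂RingHom φ (Ideal.Quotient.mk I (MvPolynomial.X i))).comp
          (lineRestrict (K := K) (A := MvPolynomial (Fin (N + 1)) K) MvPolynomial.X
            (fun j => MvPolynomial.C (p j))).toRingHom = Ideal.Quotient.mk I := by
        refine MvPolynomial.ringHom_ext (fun a => ?_) fun j => ?_
        · have h := lineRestrict_C (A := MvPolynomial (Fin (N + 1)) K) MvPolynomial.X
            (fun j => MvPolynomial.C (p j)) a
          change Polynomial.eval₂ φ _ (lineRestrict _ _ _) = _
          rw [h, Polynomial.eval₂_C, MvPolynomial.algebraMap_eq, hC]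
        · change Polynomial.eval₂ φ _ (lineRestrict _ _ _) = _
          rw [lineRestrict_X, Polynomial.eval₂_add, Polynomial.eval₂_mul, Polynomial.eval₂_C,
            Polynomial.eval₂_C, Polynomial.eval₂_X, hC, hX]
          ring
      have h2 := DFunLike.congr_fun this f
      rw [Ideal.Quotient.eq_zero_iff_mem.2 hI] at h2
      exact h2
    refine ⟨Polynomial.C (MvPolynomial.C (MvPolynomial.eval p f)⁻¹) * F, ?_, ?_⟩
    · refine Polynomial.monic_of_natDegree_le_of_coeff_eq_one d
        ((Polynomial.natDegree_C_mul_le _ _).trans (natDegree_lineRestrict_le hf _ _)) ?_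
      rw [Polynomial.coeff_C_mul, hF, coeff_lineRestrict hf]
      have : MvPolynomial.aeval (fun j => (MvPolynomial.C (p j) : MvPolynomial (Fin (N + 1)) K)) f =
          MvPolynomial.C (MvPolynomial.eval p f) := by
        have := MvPolynomial.aeval_algebraMap_apply (MvPolynomial (Fin (N + 1)) K) p f
        rw [MvPolynomial.algebraMap_eq, MvPolynomial.aeval_eq_eval] at this
        exact this
      rw [this, ← MvPolynomial.C_mul, inv_mul_cancel₀ hfp, MvPolynomial.C_1]
    · rw [Polynomial.eval₂_mul, hev, mul_zero]
  intro x
  obtain ⟨g, rfl⟩ := Ideal.Quotient.mk_surjective x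
  induction g using MvPolynomial.induction_on with
  | C a => exact hC a ▸ φ.isIntegralElem_map
  | add g h hg hh => exact map_add (Ideal.Quotient.mk I) g h ▸ hg.add φ hh
  | mul_X g j hg =>
    rw [map_mul]
    refine hg.mul φ ?_
    have : Ideal.Quotient.mk I (MvPolynomial.X j) = φ (MvPolynomial.X j) +
        φ (MvPolynomial.C (p j)) * Ideal.Quotient.mk I (MvPolynomial.X i) := by
      rw [hX, hC]
      ring
    rw [this]
    exact φ.isIntegralElem_map.add φ (φ.isIntegralElem_map.mul φ hXi)

/-- Cones over closed subsets of a hypersurface missing the vertex are closed. -/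
theorem isClosed_cone_mk [IsAlgClosed K] {i : Fin (N + 1)} {p : Fin (N + 1) → K} (hp : p ≠ 0)
    (hpi : p i = 1) {d : ℕ} {f : MvPolynomial (Fin (N + 1)) K} (hf : f.IsHomogeneous d)
    (hfp : MvPolynomial.eval p f ≠ 0) {Z : Set (ℙ K (Fin (N + 1) → K))} (hZ : IsClosed Z)
    (hfZ : f ∈ coneIdeal Z) : IsClosed (cone (Projectivization.mk K p hp) Z) := by
  have : Infinite K := IsAlgClosed.instInfinite
  rcases Z.eq_empty_or_nonempty with rfl | ⟨z, hz⟩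
  · simp [cone]
  refine isClosed_of_forall_coneIdeal fun w hw hvan => ?_
  -- Here `w` represents the vertex, which lies on the cone over any nonempty set.
  by_cases hwp : w - w i • p = 0
  · induction z using Projectivization.ind with
    | h v hv =>
    exact (mk_mem_cone_iff hp hw).2 ⟨v, hv, hz, 0, w i, by
      rw [zero_smul, zero_add, ← sub_eq_zero.1 hwp]⟩
  set φ := (Ideal.Quotient.mk (coneIdeal Z)).comp (projHom i p).toRingHom with hφ
  have hint : φ.IsIntegral := isIntegral_projHom hf hfp hfZ
  let := φ.toAlgebra
  have : Algebra.IsIntegral (MvPolynomial (Fin (N + 1)) K)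
    (MvPolynomial (Fin (N + 1)) K ⧸ coneIdeal Z) := ⟨hint⟩
  have hmax : (MvPolynomial.vanishingIdeal K {w - w i • p}).IsMaximal :=
    MvPolynomial.isMaximal_iff_eq_vanishingIdeal_singleton.2 ⟨_, rfl⟩
  -- Lying over: the maximal ideal of the projected point lifts to the coordinate ring of the affine
  -- cone over `Z`. By the Nullstellensatz the lift is a point `u` with the same projection as `w`.
  obtain ⟨Q, hQ, hQcomap⟩ := Ideal.exists_ideal_over_maximal_of_isIntegral
    (S := MvPolynomial (Fin (N + 1)) K ⧸ coneIdeal Z)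
    (MvPolynomial.vanishingIdeal K {w - w i • p}) (by
      intro g hg
      have hg : φ g = 0 := hg
      have hg' : projHom i p g ∈ coneIdeal Z := Ideal.Quotient.eq_zero_iff_mem.1 hg
      have := hvan _ (comap_projHom_coneIdeal_le hp hpi hg')
      change MvPolynomial.eval w (projHom i p g) = 0 at this
      rw [eval_projHom] at this
      rw [MvPolynomial.mem_vanishingIdeal_singleton_iff, MvPolynomial.aeval_eq_eval]
      exact this)
  have hQmax : (Q.comap (Ideal.Quotient.mk (coneIdeal Z))).IsMaximal :=
    Ideal.comap_isMaximal_of_surjective _ Ideal.Quotient.mk_surjective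
  obtain ⟨u, hu⟩ := MvPolynomial.isMaximal_iff_eq_vanishingIdeal_singleton.1 hQmax
  have hmem : ∀ g, MvPolynomial.eval u g = 0 ↔ Ideal.Quotient.mk (coneIdeal Z) g ∈ Q := by
    intro g
    rw [← Ideal.mem_comap, hu, MvPolynomial.mem_vanishingIdeal_singleton_iff,
      MvPolynomial.aeval_eq_eval]
  have hproj : u - u i • p = w - w i • p := by
    ext j
    set g : MvPolynomial (Fin (N + 1)) K :=
      MvPolynomial.X j - MvPolynomial.C ((w - w i • p) j) with hg
    have h1 : g ∈ MvPolynomial.vanishingIdeal K {w - w i • p} := by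
      rw [MvPolynomial.mem_vanishingIdeal_singleton_iff]
      simp [hg]
    rw [← hQcomap, Ideal.mem_comap] at h1
    have h2 := (hmem (projHom i p g)).2 h1
    rw [eval_projHom] at h2
    simpa [hg, sub_eq_zero] using h2
  have hu0 : u ≠ 0 := by
    rintro rfl
    exact hwp (by simp [← hproj])
  have huZ : Projectivization.mk K u hu0 ∈ Z := mk_mem_of_isClosed hZ hu0 fun g hg =>
    (hmem g).2 (by rw [Ideal.Quotient.eq_zero_iff_mem.2 hg]; exact Q.zero_mem)
  refine (mk_mem_cone_iff hp hw).2 ⟨u, hu0, huZ, 1, w i - u i, ?_⟩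
  rw [one_smul, sub_smul]
  linear_combination hproj

/-- Incomparability for the projection from a point off a hypersurface. -/
theorem subset_of_subset_cone_mk [Infinite K] {i : Fin (N + 1)} {p : Fin (N + 1) → K} (hp : p ≠ 0)
    (hpi : p i = 1) {d : ℕ} {f : MvPolynomial (Fin (N + 1)) K} (hf : f.IsHomogeneous d)
    (hfp : MvPolynomial.eval p f ≠ 0) {Y Z : Set (ℙ K (Fin (N + 1) → K))} (hY : IsClosed Y)
    (hZ : IsIrreducible Z) (hfZ : f ∈ coneIdeal Z) (hYZ : Y ⊆ Z)
    (hZY : Z ⊆ cone (Projectivization.mk K p hp) Y) : Z ⊆ Y := by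
  have hprime := isPrime_coneIdeal hZ
  intro x hx
  induction x using Projectivization.ind with
  | h v hv =>
  refine mk_mem_of_isClosed hY hv fun g hgY => ?_
  by_contra hgv
  have hgZ : g ∉ coneIdeal Z := fun h => hgv (h v hv hx)
  obtain ⟨q, hq, hqg⟩ := isIntegral_projHom (i := i) hf hfp hfZ
    (Ideal.Quotient.mk (coneIdeal Z) g)
  rw [← Polynomial.hom_eval₂, Ideal.Quotient.eq_zero_iff_mem] at hqg
  have : ((coneIdeal Z).comap (projHom i p).toRingHom).IsPrime := Ideal.comap_isPrime _ _
  -- An integral equation of `g` over the projection has a coefficient whose pullback vanishes on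
  -- `Y` but not on `Z`. This contradicts `Z` lying in the cone over `Y`.
  obtain ⟨k, hk⟩ := Ideal.exists_coeff_mem_comap_sdiff_comap_of_root_mem_sdiff
    (f := (projHom i p).toRingHom) (coneIdeal_anti hYZ) ⟨hgY, hgZ⟩ (hq.map _).ne_zero hqg
  exact hk.2 (coneIdeal_anti hZY (comap_projHom_coneIdeal_le hp hpi hk.1))

end Projection

/-! ### The same results without coordinates -/

section Hypersurface

variable {K : Type*} [Field K] {N : ℕ}

/-- The normalization `p i = 1` is what makes `v ↦ v - v i • p` a projection killing `p`. -/
theorem exists_mk_eq (P : ℙ K (Fin (N + 1) → K)) :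
    ∃ (p : Fin (N + 1) → K) (hp : p ≠ 0) (i : Fin (N + 1)),
      p i = 1 ∧ P = Projectivization.mk K p hp := by
  induction P using Projectivization.ind with
  | h v hv =>
  obtain ⟨i, hi⟩ := Function.ne_iff.1 hv
  have hi : v i ≠ 0 := hi
  have hne : (v i)⁻¹ • v ≠ 0 := smul_ne_zero (inv_ne_zero hi) hv
  exact ⟨(v i)⁻¹ • v, hne, i, by simp [hi],
    (Projectivization.mk_eq_mk_iff' K _ _ hv hne).2 ⟨v i, by simp [smul_smul, hi]⟩⟩

theorem mem_coneIdeal_of_subset_zeroLocus {d : ℕ} {f : MvPolynomial (Fin (N + 1)) K}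
    (hf : f.IsHomogeneous d) {Z : Set (ℙ K (Fin (N + 1) → K))} (hZ : Z ⊆ zeroLocus {f}) :
    f ∈ coneIdeal Z := fun _ hv hvZ => (mk_mem_zeroLocus_singleton hf hv).1 (hZ hvZ)

theorem isClosed_cone [IsAlgClosed K] {W Z : Set (ℙ K (Fin (N + 1) → K))}
    {P : ℙ K (Fin (N + 1) → K)} (hW : IsHypersurface W) (hP : P ∉ W) (hZ : IsClosed Z)
    (hZW : Z ⊆ W) : IsClosed (cone P Z) := by
  obtain ⟨d, f, -, -, hf, rfl⟩ := hW
  obtain ⟨p, hp, i, hpi, rfl⟩ := exists_mk_eq P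
  exact isClosed_cone_mk hp hpi hf (fun h => hP ((mk_mem_zeroLocus_singleton hf hp).2 h)) hZ
    (mem_coneIdeal_of_subset_zeroLocus hf hZW)

theorem subset_of_subset_cone [Infinite K] {W Y Z : Set (ℙ K (Fin (N + 1) → K))}
    {P : ℙ K (Fin (N + 1) → K)} (hW : IsHypersurface W) (hP : P ∉ W) (hY : IsClosed Y)
    (hZ : IsIrreducible Z) (hZW : Z ⊆ W) (hYZ : Y ⊆ Z) (hZY : Z ⊆ cone P Y) : Z ⊆ Y := by
  obtain ⟨d, f, -, -, hf, rfl⟩ := hW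
  obtain ⟨p, hp, i, hpi, rfl⟩ := exists_mk_eq P
  exact subset_of_subset_cone_mk hp hpi hf
    (fun h => hP ((mk_mem_zeroLocus_singleton hf hp).2 h)) hY hZ
    (mem_coneIdeal_of_subset_zeroLocus hf hZW) hYZ hZY

end Hypersurface

/-! ### Linear forms, and polynomials with 0 as only root -/

section LinearForm

variable {K : Type*} [Field K] {σ : Type*}

theorem eval_add_of_isHomogeneous_one {g : MvPolynomial σ K} (hg : g.IsHomogeneous 1)
    (v w : σ → K) :
    MvPolynomial.eval (v + w) g = MvPolynomial.eval v g + MvPolynomial.eval w g := by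
  rw [← MvPolynomial.mem_homogeneousSubmodule, MvPolynomial.homogeneousSubmodule_one_eq_span_X] at hg
  induction hg using Submodule.span_induction with
  | mem x h =>
    obtain ⟨i, rfl⟩ := h
    simp
  | zero => simp
  | add x y _ _ hx hy =>
    rw [map_add, map_add, map_add, hx, hy]
    ring
  | smul a x _ hx => rw [MvPolynomial.smul_eval, MvPolynomial.smul_eval, MvPolynomial.smul_eval,
      hx, mul_add]

/-- The linear form cut out by a homogeneous polynomial of degree one. -/
noncomputable def linearFormOfIsHomogeneous {g : MvPolynomial σ K} (hg : g.IsHomogeneous 1) :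
    (σ → K) →ₗ[K] K where
  toFun v := MvPolynomial.eval v g
  map_add' := eval_add_of_isHomogeneous_one hg
  map_smul' a v := by simpa using eval_smul_of_isHomogeneous hg a v

theorem eq_C_mul_X_pow_of_forall_root [IsAlgClosed K] {q : Polynomial K} {d : ℕ} {c : K}
    (hc : c ≠ 0) (hdeg : q.natDegree ≤ d) (hcoeff : q.coeff d = c)
    (hroot : ∀ t, q.eval t = 0 → t = 0) : q = Polynomial.C c * Polynomial.X ^ d := by
  have hd : q.natDegree = d :=
    le_antisymm hdeg (Polynomial.le_natDegree_of_ne_zero (hcoeff ▸ hc))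
  have hsplit := IsAlgClosed.splits q
  have hroots : q.roots = Multiset.replicate d 0 := by
    rw [Multiset.eq_replicate]
    exact ⟨by rw [← hd, hsplit.natDegree_eq_card_roots],
      fun t ht => hroot t (Polynomial.isRoot_of_mem_roots ht)⟩
  have h := hsplit.eq_prod_roots
  rw [hroots, Polynomial.leadingCoeff, hd, hcoeff] at h
  simpa using h

end LinearForm

/-! ### Iterated polars of a form -/

section Polar

variable {K : Type*} [Field K] {σ : Type*} [Fintype σ]

/-- The directional derivative `∑ pᵢ ∂ᵢ`. -/
noncomputable def directionalDerivation (p : σ → K) :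
    Derivation K (MvPolynomial σ K) (MvPolynomial σ K) :=
  ∑ i, (MvPolynomial.C (p i) : MvPolynomial σ K) • MvPolynomial.pderiv i

theorem directionalDerivation_apply (p : σ → K) (g : MvPolynomial σ K) :
    directionalDerivation p g = ∑ i, MvPolynomial.C (p i) * MvPolynomial.pderiv i g := by
  have := congrFun (map_sum Derivation.coeFnAddMonoidHom (fun i =>
    (MvPolynomial.C (p i) : MvPolynomial σ K) • MvPolynomial.pderiv (R := K) i) Finset.univ) g
  rw [Finset.sum_apply] at this
  exact this

theorem directionalDerivation_X (p : σ → K) (j : σ) :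
    directionalDerivation p (MvPolynomial.X j) = MvPolynomial.C (p j) := by
  classical
  rw [directionalDerivation_apply, Finset.sum_eq_single j]
  · simp
  · intro i _ hij
    rw [MvPolynomial.pderiv_X_of_ne hij.symm, mul_zero]
  · simp

theorem isHomogeneous_directionalDerivation (p : σ → K) {d : ℕ} {g : MvPolynomial σ K}
    (hg : g.IsHomogeneous d) : (directionalDerivation p g).IsHomogeneous (d - 1) := by
  rw [directionalDerivation_apply]
  refine MvPolynomial.IsHomogeneous.sum _ _ _ fun i _ => ?_
  simpa using (MvPolynomial.isHomogeneous_C σ (p i)).mul (hg.pderiv (i := i))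

theorem isHomogeneous_iterate_directionalDerivation (p : σ → K) {d : ℕ} {g : MvPolynomial σ K}
    (hg : g.IsHomogeneous d) (k : ℕ) :
    ((directionalDerivation p)^[k] g).IsHomogeneous (d - k) := by
  induction k with
  | zero => simpa using hg
  | succ k ih =>
    rw [Function.iterate_succ_apply', ← Nat.sub_sub]
    exact isHomogeneous_directionalDerivation p ih

theorem derivative_lineRestrict (v p : σ → K) (g : MvPolynomial σ K) :
    Polynomial.derivative (lineRestrict v p g) = lineRestrict v p (directionalDerivation p g) := by
  induction g using MvPolynomial.induction_on with
  | C a =>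
    have : directionalDerivation p (MvPolynomial.C a) = 0 :=
      (directionalDerivation p).map_algebraMap a
    rw [lineRestrict_C, this, map_zero, Polynomial.derivative_C]
  | add g h hg hh => rw [map_add, map_add, map_add, map_add, hg, hh]
  | mul_X g j hg =>
    rw [map_mul, Polynomial.derivative_mul, hg, Derivation.leibniz, map_add, smul_eq_mul,
      smul_eq_mul, map_mul, map_mul, directionalDerivation_X, lineRestrict_C, lineRestrict_X]
    simp
    ring

theorem iterate_derivative_lineRestrict (v p : σ → K) (g : MvPolynomial σ K) (k : ℕ) :
    Polynomial.derivative^[k] (lineRestrict v p g) =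
      lineRestrict v p ((directionalDerivation p)^[k] g) := by
  induction k with
  | zero => rfl
  | succ k ih => rw [Function.iterate_succ_apply', Function.iterate_succ_apply', ih,
      derivative_lineRestrict]

/-- If the restrictions of `f` to the lines `v + T p` vanish only at `T = 0`, for `v` in a set `S`,
then a linear form not vanishing at `p` vanishes on `S`. -/
theorem exists_linearForm [IsAlgClosed K] [CharZero K] {d : ℕ} (hd : 0 < d) {f : MvPolynomial σ K}
    (hf : f.IsHomogeneous d) {p : σ → K} (hfp : MvPolynomial.eval p f ≠ 0) (S : Set (σ → K))
    (hS : ∀ v ∈ S, ∀ t : K, MvPolynomial.eval (v + t • p) f = 0 → t = 0) :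
    ∃ l : (σ → K) →ₗ[K] K, l p ≠ 0 ∧ ∀ v ∈ S, l v = 0 := by
  have hl : ((directionalDerivation p)^[d - 1] f).IsHomogeneous 1 := by
    have := isHomogeneous_iterate_directionalDerivation p hf (d - 1)
    rwa [Nat.sub_sub_self hd] at this
  have key : ∀ v : σ → K, (∀ t : K, MvPolynomial.eval (v + t • p) f = 0 → t = 0) → ∀ t : K,
      MvPolynomial.eval (v + t • p) ((directionalDerivation p)^[d - 1] f) =
        MvPolynomial.eval p f * (d.descFactorial (d - 1) : K) * t := by
    intro v hv t
    have h1 : lineRestrict v p f = Polynomial.C (MvPolynomial.eval p f) * Polynomial.X ^ d :=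
      eq_C_mul_X_pow_of_forall_root hfp (natDegree_lineRestrict_le hf v p)
        (by rw [coeff_lineRestrict hf, MvPolynomial.aeval_eq_eval])
        fun t ht => hv t (by rwa [eval_lineRestrict] at ht)
    rw [← eval_lineRestrict, ← iterate_derivative_lineRestrict, h1,
      Polynomial.iterate_derivative_C_mul, Polynomial.iterate_derivative_X_pow_eq_C_mul,
      Nat.sub_sub_self hd]
    simp [mul_assoc]
  refine ⟨linearFormOfIsHomogeneous hl, ?_, fun v hv => ?_⟩
  -- The zero vector qualifies for `key` because `f(t p) = t ^ d f(p)`; `t = 1` then gives the value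
  -- at `p`, whose factor `d.descFactorial (d - 1)` is nonzero in characteristic 0.
  · have h := key 0 (fun t ht => ?_) 1
    · rw [zero_add, one_smul, mul_one] at h
      change MvPolynomial.eval p _ ≠ 0
      rw [h]
      exact mul_ne_zero hfp (Nat.cast_ne_zero.2 (Nat.descFactorial_eq_zero_iff_lt.not.2 (by omega)))
    · rw [zero_add, eval_smul_of_isHomogeneous hf, mul_eq_zero] at ht
      exact pow_eq_zero_iff hd.ne' |>.1 (ht.resolve_right hfp)
  · have h := key v (hS v hv) 0
    rwa [zero_smul, add_zero, mul_zero] at h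

end Polar

/-! ### Points outside `X`, irreducibility and dimension -/

section Main

variable {K : Type*} [Field K] {N : ℕ}

theorem eq_zero_of_isNondegenerate {X : Set (ℙ K (Fin (N + 1) → K))} (hX : IsNondegenerate X)
    {l : (Fin (N + 1) → K) →ₗ[K] K}
    (hl : ∀ (v : Fin (N + 1) → K) (hv : v ≠ 0), Projectivization.mk K v hv ∈ X → l v = 0) :
    l = 0 := by
  have h : Projectivization.Subspace.span X ≤ (LinearMap.ker l).projectivization := by
    rw [Projectivization.Subspace.span_le_subspace_iff]
    intro x hx
    induction x using Projectivization.ind with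
    | h v hv => exact (Submodule.mk_mem_projectivization_iff _ hv).2 (hl v hv hx)
  rw [show Projectivization.Subspace.span X = ⊤ from hX, top_le_iff,
    map_eq_top_iff] at h
  exact LinearMap.ker_eq_top.1 h

theorem not_cone_inter_subset [IsAlgClosed K] [CharZero K] {X W : Set (ℙ K (Fin (N + 1) → K))}
    {P : ℙ K (Fin (N + 1) → K)} (hX : IsNondegenerate X) (hW : IsHypersurface W) (hXW : X ⊆ W)
    (hP : P ∉ W) (hrank : rank X P ≠ 2) : ¬ cone P X ∩ W ⊆ X := by
  intro hsub
  obtain ⟨d, f, hd, -, hf, rfl⟩ := hW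
  obtain ⟨p, hp, i, hpi, rfl⟩ := exists_mk_eq P
  have hfp : MvPolynomial.eval p f ≠ 0 := fun h => hP ((mk_mem_zeroLocus_singleton hf hp).2 h)
  have hS : ∀ v ∈ {v | ∃ hv : v ≠ 0, Projectivization.mk K v hv ∈ X}, ∀ t : K,
      MvPolynomial.eval (v + t • p) f = 0 → t = 0 := by
    rintro v ⟨hv, hvX⟩ t ht
    have hPX : Projectivization.mk K p hp ∉ X := fun h => hP (hXW h)
    have hne : ∀ a : K, a • v ≠ p := fun a ha => hPX (by
      rwa [(Projectivization.mk_eq_mk_iff' K _ _ hp hv).2 ⟨a, ha⟩])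
    -- A root `t ≠ 0` gives a point of the cone in `W`, hence in `X`, and so equal to the point of
    -- `v` by injectivity; then `p` is a multiple of `v`.
    by_contra ht0
    have hw : v + t • p ≠ 0 := fun h => hne (-t⁻¹) (by
      rw [eq_neg_of_add_eq_zero_left h, neg_smul_neg, smul_smul, inv_mul_cancel₀ ht0, one_smul])
    have hcone : Projectivization.mk K _ hw ∈ cone (Projectivization.mk K p hp) X :=
      (mk_mem_cone_iff hp hw).2 ⟨v, hv, hvX, 1, t, by rw [one_smul]⟩
    have hwX := hsub ⟨hcone, (mk_mem_zeroLocus_singleton hf hw).2 ht⟩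
    have := eq_of_mem_span_pair_of_rank_ne_two hPX hrank hvX hwX
      ((mk_mem_span_pair_iff hv hp hw).2 (Submodule.mem_span_pair.2 ⟨1, t, by rw [one_smul]⟩))
    obtain ⟨a, ha⟩ := (Projectivization.mk_eq_mk_iff' K _ _ hw hv).1 this
    refine hne (t⁻¹ * (a - 1)) ?_
    rw [mul_smul, sub_smul, ha, one_smul, add_sub_cancel_left, smul_smul, inv_mul_cancel₀ ht0,
      one_smul]
  obtain ⟨l, hlp, hl⟩ := exists_linearForm hd hf hfp _ hS
  exact hlp (by
    rw [eq_zero_of_isNondegenerate hX fun v hv hvX => hl v ⟨hv, hvX⟩, LinearMap.zero_apply])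

theorem isIrreducible_preimage_val {T : Type*} [TopologicalSpace T] {S Z : Set T}
    (hZ : IsIrreducible Z) (h : Z ⊆ S) : IsIrreducible ((↑) ⁻¹' Z : Set S) := by
  obtain ⟨z, hz⟩ := hZ.nonempty
  refine ⟨⟨⟨z, h hz⟩, hz⟩, ?_⟩
  rintro _ _ ⟨U, hU, rfl⟩ ⟨V, hV, rfl⟩ ⟨x, hx, hxU⟩ ⟨y, hy, hyV⟩
  obtain ⟨w, hw, hwUV⟩ := hZ.isPreirreducible U V hU hV ⟨x, hx, hxU⟩ ⟨y, hy, hyV⟩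
  exact ⟨⟨w, h hw⟩, hw, hwUV⟩

/-- A closed cover `A ∪ B` of `X ∩ cone P Z` yields a closed cover of `Z` by the cones over `X ∩ A`
and `X ∩ B`. One of them contains `Z`, and injectivity on `X` brings the inclusion back to `A` or
`B`. -/
theorem isIrreducible_inter_cone [IsAlgClosed K] {X W Z : Set (ℙ K (Fin (N + 1) → K))}
    {P : ℙ K (Fin (N + 1) → K)} (hX : IsClosed X) (hW : IsHypersurface W) (hXW : X ⊆ W)
    (hP : P ∉ W) (hrank : rank X P ≠ 2) (hZ : IsIrreducible Z) (hZX : Z ⊆ cone P X ∩ W) :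
    IsIrreducible (X ∩ cone P Z) := by
  have hZP : ∀ z ∈ Z, z ≠ P := fun z hz h => hP (h ▸ (hZX hz).2)
  obtain ⟨z, hz⟩ := hZ.nonempty
  obtain ⟨x, hx, hzx⟩ := mem_cone.1 (hZX hz).1
  refine ⟨⟨x, hx, mem_cone_of_mem_cone hzx (hZP z hz) (subset_cone P Z hz)⟩, ?_⟩
  rw [isPreirreducible_iff_isClosed_union_isClosed]
  intro A B hA hB hAB
  have hcl : ∀ {C}, IsClosed C → IsClosed (cone P (X ∩ C)) := fun hC =>
    isClosed_cone hW hP (hX.inter hC) (Set.inter_subset_left.trans hXW)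
  have hsub : ∀ {C}, Z ⊆ cone P (X ∩ C) → X ∩ cone P Z ⊆ C := fun h =>
    (Set.inter_subset_inter_right X ((cone_mono P h).trans (cone_cone_subset P _))).trans
      ((inter_cone_of_rank_ne_two (fun h => hP (hXW h)) hrank Set.inter_subset_left).trans
        Set.inter_subset_right)
  refine (isPreirreducible_iff_isClosed_union_isClosed.1 hZ.isPreirreducible _ _ (hcl hA) (hcl hB)
    fun y hy => ?_).imp hsub hsub
  obtain ⟨x, hx, hyx⟩ := mem_cone.1 (hZX hy).1
  rw [← cone_union, ← Set.inter_union_distrib_left]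
  exact mem_cone.2 ⟨x, ⟨hx, hAB ⟨hx, mem_cone_of_mem_cone hyx (hZP y hy) (subset_cone P Z hy)⟩⟩,
    hyx⟩

/-- `F` carries chains of irreducible closed sets from `A` to `B`; `hanti` keeps them strict. -/
theorem topologicalKrullDim_le_of_map {T : Type*} [TopologicalSpace T] {A B : Set T}
    (hA : IsClosed A) (F : Set T → Set T)
    (hF : ∀ Z ⊆ A, IsClosed Z → IsIrreducible Z → IsClosed (F Z) ∧ IsIrreducible (F Z) ∧ F Z ⊆ B)
    (hmono : ∀ Y Z, Y ⊆ Z → F Y ⊆ F Z)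
    (hanti : ∀ Y Z, Z ⊆ A → IsClosed Y → IsIrreducible Z → Y ⊆ Z → F Z ⊆ F Y → Z ⊆ Y) :
    topologicalKrullDim A ≤ topologicalKrullDim B := by
  have hsub (Z : TopologicalSpace.IrreducibleCloseds A) : ((↑) '' (Z : Set A) : Set T) ⊆ A :=
    Subtype.coe_image_subset _ _
  have hcl (Z : TopologicalSpace.IrreducibleCloseds A) : IsClosed ((↑) '' (Z : Set A) : Set T) :=
    hA.isClosedMap_subtype_val _ Z.isClosed
  have hirr (Z : TopologicalSpace.IrreducibleCloseds A) :
      IsIrreducible ((↑) '' (Z : Set A) : Set T) :=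
    Z.isIrreducible.image _ continuous_subtype_val.continuousOn
  have hFZ (Z : TopologicalSpace.IrreducibleCloseds A) := hF _ (hsub Z) (hcl Z) (hirr Z)
  refine Order.krullDim_le_of_strictMono (fun Z => ⟨(↑) ⁻¹' F ((↑) '' (Z : Set A)),
    isIrreducible_preimage_val (hFZ Z).2.1 (hFZ Z).2.2,
    (hFZ Z).1.preimage continuous_subtype_val⟩) fun Y Z hlt => ?_
  have hle : ((↑) '' (Y : Set A) : Set T) ⊆ (↑) '' (Z : Set A) := Set.image_mono hlt.le
  refine lt_of_le_not_ge (fun x hx => hmono _ _ hle hx) fun hge => hlt.not_ge ?_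
  have hge' : F ((↑) '' (Z : Set A)) ⊆ F ((↑) '' (Y : Set A)) := fun x hx =>
    hge (show (⟨x, (hFZ Z).2.2 hx⟩ : B) ∈ _ from hx)
  exact (Set.image_subset_image_iff Subtype.val_injective).1
    (hanti _ _ (hsub Z) (hcl Y) (hirr Z) hle hge')

theorem IsHypersurface.isClosed {W : Set (ℙ K (Fin (N + 1) → K))} (hW : IsHypersurface W) :
    IsClosed W := by
  obtain ⟨d, f, -, -, hf, rfl⟩ := hW
  exact isClosed_zeroLocus_singleton hf

theorem dim_cone_inter_le [IsAlgClosed K] {X W : Set (ℙ K (Fin (N + 1) → K))}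
    {P : ℙ K (Fin (N + 1) → K)} (hX : IsClosed X) (hW : IsHypersurface W) (hXW : X ⊆ W)
    (hP : P ∉ W) (hrank : rank X P ≠ 2) : dim (cone P X ∩ W) ≤ dim X := by
  have : Infinite K := IsAlgClosed.instInfinite
  refine topologicalKrullDim_le_of_map ((isClosed_cone hW hP hX hXW).inter hW.isClosed)
    (fun Z => X ∩ cone P Z) (fun Z hZ hZcl hZirr => ⟨?_, ?_, Set.inter_subset_left⟩)
    (fun Y Z h => Set.inter_subset_inter_right X (cone_mono P h)) fun Y Z hZ hY hZirr hYZ hZY => ?_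
  · exact hX.inter (isClosed_cone hW hP hZcl (hZ.trans Set.inter_subset_right))
  · exact isIrreducible_inter_cone hX hW hXW hP hrank hZirr hZ
  -- Each `y ∈ Z` projects to the same point as some `x ∈ X ∩ cone P Z`, and this `x` lies in `cone
  -- P Y`; so `Z ⊆ cone P Y` and incomparability applies.
  · refine subset_of_subset_cone hW hP hY hZirr (hZ.trans Set.inter_subset_right) hYZ
      fun y hy => ?_
    have hyP : y ≠ P := fun h => hP (h ▸ (hZ hy).2)
    obtain ⟨x, hx, hyx⟩ := mem_cone.1 (hZ hy).1
    have hxY := hZY ⟨hx, mem_cone_of_mem_cone hyx hyP (subset_cone P Z hy)⟩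
    exact cone_cone_subset P Y (mem_cone.2 ⟨x, hxY.2, hyx⟩)

end Main

end ProjGeom

/-! ### The theorem -/

theorem mainTheorem2 {K : Type*} [Field K] [IsAlgClosed K] [CharZero K] (N n : ℕ)
    (X W : Set (ℙ K (Fin (N + 1) → K))) (P : ℙ K (Fin (N + 1) → K))
    (hX : ProjGeom.IsIrreducibleVariety X) (hXnd : ProjGeom.IsNondegenerate X)
    (hXdim : ProjGeom.dim X = n)
    (hW : ProjGeom.IsHypersurface W) (hXW : X ⊂ W)
    (hP : P ∉ W) (hrank : ProjGeom.rank X P ≠ 2) :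
    ProjGeom.IsReducible (ProjGeom.cone P X ∩ W) ∧
    ProjGeom.dim (ProjGeom.cone P X ∩ W) = n ∧
    ∃ L : Projectivization.Subspace K (Fin (N + 1) → K),
      ProjGeom.IsLine L ∧ P ∈ L ∧
      (L : Set (ℙ K (Fin (N + 1) → K))) ⊆ ProjGeom.cone P X ∧
      (∃ Q, (L : Set (ℙ K (Fin (N + 1) → K))) ∩ X = {Q}) ∧
      ((L : Set (ℙ K (Fin (N + 1) → K))) ∩ (W \ X)).Nonempty := by
  have : Infinite K := IsAlgClosed.instInfinite
  have hnot := ProjGeom.not_cone_inter_subset hXnd hW hXW.subset hP hrank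
  have hsub : X ⊆ ProjGeom.cone P X ∩ W :=
    Set.subset_inter (ProjGeom.subset_cone P X) hXW.subset
  have hPX : P ∉ X := fun h => hP (hXW.subset h)
  have hcl : IsClosed (ProjGeom.cone P X ∩ W) :=
    (ProjGeom.isClosed_cone hW hP hX.1 hXW.subset).inter hW.isClosed
  refine ⟨?_, le_antisymm ?_ ?_, ?_⟩
  · have hirr : ¬ IsIrreducible (ProjGeom.cone P X ∩ W) := fun hirr =>
      hnot (ProjGeom.subset_of_subset_cone hW hP hX.1 hirr Set.inter_subset_right hsub
        Set.inter_subset_left)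
    have hpre : ¬ IsPreirreducible (ProjGeom.cone P X ∩ W) := fun h =>
      hirr ⟨hX.2.nonempty.mono hsub, h⟩
    rw [isPreirreducible_iff_isClosed_union_isClosed] at hpre
    push Not at hpre
    obtain ⟨A, B, hA, hB, hAB, hnA, hnB⟩ := hpre
    refine ⟨(ProjGeom.cone P X ∩ W) ∩ A, (ProjGeom.cone P X ∩ W) ∩ B, hcl.inter hA, hcl.inter hB,
      ?_, fun h => hnA (Set.inter_eq_left.1 h), fun h => hnB (Set.inter_eq_left.1 h)⟩
    rw [← Set.inter_union_distrib_left, Set.inter_eq_left.2 hAB]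
  · exact hXdim ▸ ProjGeom.dim_cone_inter_le hX.1 hW hXW.subset hP hrank
  · exact hXdim ▸ (Topology.IsInducing.subtypeVal.of_comp (continuous_inclusion hsub)
      continuous_subtype_val).topologicalKrullDim_le
  -- The line is the ruling of the cone through a point `y` of `W` outside `X`.
  · obtain ⟨y, hy, hyX⟩ := Set.not_subset.1 hnot
    obtain ⟨x, hx, hyx⟩ := ProjGeom.mem_cone.1 hy.1
    refine ⟨Projectivization.Subspace.span {x, P}, ?_,
      Projectivization.Subspace.subset_span _ (by simp),
      fun z hz => ProjGeom.mem_cone.2 ⟨x, hx, hz⟩, ⟨x, ?_⟩, ⟨y, hyx, hy.2, hyX⟩⟩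
    · have hxP : x ≠ P := fun h => hPX (h ▸ hx)
      induction x using Projectivization.ind with
      | h v hv =>
      induction P using Projectivization.ind with
      | h p hp =>
      have hli : LinearIndependent K ![v, p] := by
        rw [LinearIndependent.pair_iff' hv]
        exact fun a ha => hxP ((Projectivization.mk_eq_mk_iff' K _ _ hp hv).2 ⟨a, ha⟩).symm
      have := finrank_span_eq_card hli
      rw [ProjGeom.IsLine, ProjGeom.submodule_span_pair hv hp]
      rwa [Matrix.range_cons_cons_empty, Fintype.card_fin] at this
    · ext z
      constructor
      · rintro ⟨hz, hzX⟩
        exact ProjGeom.eq_of_mem_span_pair_of_rank_ne_two hPX hrank hx hzX hz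
      · rintro rfl
        exact ⟨Projectivization.Subspace.subset_span _ (by simp), hx⟩
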